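/- Let $r>0$, $d,m\in\mathbb N$, $\tfrac12<\nu\le 1$, $\beta_0\in(1-\nu,\nu)$ and $\beta\in(\beta_0,\nu)$. For $h:[a,b]\to\mathbb R^k$ and $0<\alpha\le 1$ put $$|||h|||_{\alpha,[a,b]}=\sup_{a\le s<t\le b}\frac{\|h(t)-h(s)\|}{(t-s)^\alpha},\qquad \|h\|_{\alpha,[a,b]}=\sup_{t\in[a,b]}\|h(t)\|+(b-a)^\alpha\,|||h|||_{\alpha,[a,b]},$$ and let $C^\alpha([a,b])$ be the set of those $h$ with $|||h|||_{\alpha,[a,b]}<\infty$. Let $\mathcal C_r=C([-r,0],\mathbb R^d)$ with the supremum norm, and for a path $y$ on $[-r,\infty)$ and $t\ge0$ let $y_t\in\mathcal C_r$, $y_t(s)=y(t+s)$. Let $A\in\mathbb R^{d\times d}$, let $f:\mathcal C_r\to\mathbb R^d$ be Lipschitz continuous with constant $C_f\ge 0$, let $g:\mathcal C_r\to\mathbb R^{d\times m}$ be continuously Fréchet differentiable with $\|Dg(\xi)\|\le C_g$ for all $\xi\in\mathcal C_r$, where $C_g>0$ (matrices carry the operator norm), and let $x:[0,\infty)\to\mathbb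 R^m$ belong to $C^\nu([0,T])$ for every $T>0$. Let $\eta\in\mathcal C_r$ and let $y:[-r,\infty)\to\mathbb R^d$ be a solution of the Young delay equation $$dy(t)=[Ay(t)+f(y_t)]\,dt+g(y_t)\,dx(t),\qquad y_0=\eta,$$ that is, $y_0=\eta$, $y\in C^{\beta_0}([-r,T])$ for every $T>0$, and $y(t)=y(0)+\int_0^t[Ay(u)+f(y_u)]\,du+\int_0^tg(y_u)\,dx(u)$ for all $t\ge0$, where the last integral is a Young integral (a limit of Riemann--Stieltjes sums as the mesh tends to $0$). Put $$K=\frac1{1-2^{1-(\beta+\nu)}},\quad L_f=\|A\|+C_f,\quad \kappa=4L_fr+2,\quad c=4r\|f(0)\|+\frac{\|g(0)\|}{C_g},\quad \mu=\frac1{2(K+1)C_gr^\beta}.$$ For $n\ge0$ let $\Delta_n=[nr,(n+1)r]$, and for $n\ge1$ define the greedy times on $\Delta_n$ by $t_0=nr$ and $$t_{i+1}=\min\Big\{\sup\{t>t_i:\ (t-t_i)^{\nu-\beta}\,|||x|||_{\nu,[t_i,t]}\le\mu\},\ (n+1)r\Big\},$$ and their number by $N_n(x)=1+\max\{i:\ t_i<(n+1)r\}$.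 Then for every $n\ge1$ one has $y\in C^\beta([0,(n+1)r])$, only finitely many $i$ satisfy $t_i<(n+1)r$ (so that $N_n(x)$ is well defined), $$\|y\|_{\beta,\Delta_n}\le e^{4L_fr+\kappa N_n(x)}\big(\|y\|_{\beta,\Delta_{n-1}}+c\big)-c,$$ and $$N_n(x)\le 1+\big[2(K+1)C_gr^\nu\big]^{\frac1{\nu-\beta}}\,|||x|||_{\nu,\Delta_n}^{\frac1{\nu-\beta}}.$$ -/

import Mathlib

open Set
open scoped NNReal

/-- `h ∈ C^α(s)`: `h` is Hölder continuous with exponent `α > 0` on the set `s`. -/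
def IsHolderOn {E : Type*} [NormedAddCommGroup E] (α : ℝ) (h : ℝ → E) (s : Set ℝ) : Prop :=
  ∃ C : ℝ≥0, HolderOnWith C α.toNNReal h s

/-- The supremum norm `‖h‖_{∞,[a,b]}`. -/
noncomputable def supNormOn {E : Type*} [NormedAddCommGroup E] (h : ℝ → E) (a b : ℝ) : ℝ :=
  sSup ((fun t => ‖h t‖) '' Icc a b)

/-- The Hölder seminorm `|||h|||_{α,[a,b]} = sup_{a ≤ s < t ≤ b} ‖h t - h s‖ / (t - s) ^ α`
(it is `0` when `a = b`). -/
noncomputable def holderSeminorm {E : Type*} [NormedAddCommGroup E]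
    (α : ℝ) (h : ℝ → E) (a b : ℝ) : ℝ :=
  sSup {z : ℝ | ∃ s t : ℝ, a ≤ s ∧ s < t ∧ t ≤ b ∧ z = ‖h t - h s‖ / (t - s) ^ α}

/-- The norm `‖h‖_{α,[a,b]} = ‖h‖_{∞,[a,b]} + (b - a) ^ α * |||h|||_{α,[a,b]}`. -/
noncomputable def holderNorm {E : Type*} [NormedAddCommGroup E]
    (α : ℝ) (h : ℝ → E) (a b : ℝ) : ℝ :=
  supNormOn h a b + (b - a) ^ α * holderSeminorm α h a b

/-- For `a ≤ b`: the Young integral `∫_a^b G(u) dx(u)` exists and equals `I`, that is, the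
Riemann-Stieltjes sums of `G` against `x` over tagged partitions
`a = p 0 ≤ p 1 ≤ ... ≤ p N = b`, with tags `ξ i ∈ [p i, p (i + 1)]`, tend to `I` as the mesh
tends to `0`. -/
def HasYoungIntegral {E F : Type*} [NormedAddCommGroup E] [NormedSpace ℝ E]
    [NormedAddCommGroup F] [NormedSpace ℝ F]
    (G : ℝ → E →L[ℝ] F) (x : ℝ → E) (a b : ℝ) (I : F) : Prop :=
  ∀ ε > 0, ∃ δ > 0, ∀ (N : ℕ) (p ξ : ℕ → ℝ), p 0 = a → p N = b →
    (∀ i < N, p i ≤ p (i + 1) ∧ p (i + 1) - p i < δ ∧ ξ i ∈ Icc (p i) (p (i + 1))) →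
    ‖∑ i ∈ Finset.range N, G (ξ i) (x (p (i + 1)) - x (p i)) - I‖ < ε

/-- The space `C_r = C([-r, 0], ℝ^d)`; Mathlib's norm on it is the supremum norm. -/
abbrev DelaySpace (r : ℝ) (d : ℕ) : Type :=
  C(Icc (-r) (0 : ℝ), EuclideanSpace ℝ (Fin d))

open Classical in
/-- The segment `y_t ∈ C_r`, `y_t(s) = y(t + s)` for `s ∈ [-r, 0]`. (The value `0` is used only
if `y` is not continuous on `[t - r, t]`.) -/
noncomputable def delaySegment {d : ℕ} (r : ℝ) (y : ℝ → EuclideanSpace ℝ (Fin d)) (t : ℝ) :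
    DelaySpace r d :=
  if h : Continuous (fun s : Icc (-r) (0 : ℝ) => y (t + s)) then
    ⟨fun s : Icc (-r) (0 : ℝ) => y (t + s), h⟩
  else 0

/-- `y` is a solution on `[-r, ∞)` of the Young delay equation
`dy(t) = [A y(t) + f(y_t)] dt + g(y_t) dx(t)`, `y_0 = η`: it is locally `β₀`-Hölder on `[-r, ∞)`,
it has initial segment `η`, and for all `t ≥ 0`
`y(t) = y(0) + ∫_0^t [A y(u) + f(y_u)] du + ∫_0^t g(y_u) dx(u)`, where the first integral is a
classical one (of a continuous function when `f` is continuous) and the second one is a Young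
integral. -/
structure IsYoungDelaySolution {d m : ℕ} (r β₀ : ℝ) (A : Matrix (Fin d) (Fin d) ℝ)
    (f : DelaySpace r d → EuclideanSpace ℝ (Fin d))
    (g : DelaySpace r d → EuclideanSpace ℝ (Fin m) →L[ℝ] EuclideanSpace ℝ (Fin d))
    (x : ℝ → EuclideanSpace ℝ (Fin m)) (η : DelaySpace r d)
    (y : ℝ → EuclideanSpace ℝ (Fin d)) : Prop where
  holder : ∀ T > 0, IsHolderOn β₀ y (Icc (-r) T)
  initial : ∀ s : Icc (-r) (0 : ℝ), y s = η s
  equation : ∀ t ≥ 0, ∃ I : EuclideanSpace ℝ (Fin d),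
    HasYoungIntegral (fun u => g (delaySegment r y u)) x 0 t I ∧
    y t = y 0 +
      (∫ u in (0 : ℝ)..t, (Matrix.toEuclideanCLM (𝕜 := ℝ) A (y u) + f (delaySegment r y u))) + I

/-- The constant `K = 1 / (1 - 2 ^ (1 - (β + ν)))`. -/
noncomputable def youngConst (β ν : ℝ) : ℝ := 1 / (1 - 2 ^ (1 - (β + ν)))

/-- The greedy sequence of stopping times of the path `x` on `[a, b]` with threshold `μ`:
`t_0 = a` and
`t_{i+1} = min (sup {t > t_i | (t - t_i) ^ (ν - β) * |||x|||_{ν,[t_i,t]} ≤ μ}) b`.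
The cut-off at `b` is put inside the supremum, so that the supremum is over a bounded set, and
`t = t_i`, where the left-hand side is `0`, is admitted, so that the set is never empty. -/
noncomputable def greedyTime {E : Type*} [NormedAddCommGroup E]
    (μ ν β : ℝ) (x : ℝ → E) (a b : ℝ) : ℕ → ℝ
  | 0 => a
  | i + 1 => sSup {t : ℝ | t ∈ Icc (greedyTime μ ν β x a b i) b ∧
      (t - greedyTime μ ν β x a b i) ^ (ν - β) *
        holderSeminorm ν x (greedyTime μ ν β x a b i) t ≤ μ}

/-- The set of indices `{i | t_i < b}` of the greedy times on `[a, b]` before `b`. -/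
def greedyIndices {E : Type*} [NormedAddCommGroup E]
    (μ ν β : ℝ) (x : ℝ → E) (a b : ℝ) : Set ℕ :=
  {i : ℕ | greedyTime μ ν β x a b i < b}

/-- The number `1 + max {i | t_i < b}` of greedy times on `[a, b]`; it is meaningful if
`greedyIndices` is finite. -/
noncomputable def greedyCount {E : Type*} [NormedAddCommGroup E]
    (μ ν β : ℝ) (x : ℝ → E) (a b : ℝ) : ℕ :=
  1 + sSup (greedyIndices μ ν β x a b)

/-! ### Hölder seminorms and supremum norms on subintervals. -/

section HolderNorm

variable {E : Type*} [NormedAddCommGroup E] {α : ℝ} {h : ℝ → E} {a b : ℝ}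

/-! The Young-Loève estimate bounds an increment of `y` over `[s, t]` by a drift term of order `t -
s`, a term of order `(t - s) ^ ν` and a remainder of order `(t - s) ^ (β + ν)`. With `β₀` in place
of `β` this gives the `β`-regularity on `[0, T]`.

For the growth bound put `a = n * r` and follow `Φ t`, the sum of the supremum norm of `y` on `[a -
r, t]`, `ℓ ^ β` times its `β`-seminorm there, and `c`. The window starts at `a - r`, so it contains
every delay segment that enters the equation on `[a, t]`. Here `ℓ = r / (M + 1)` with `M = ⌊4 * L *
r⌋₊`, so that the drift contributes at most `1 / 4`. On an interval lying in one greedy interval and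
in one cell of length `ℓ`, the terms containing the unknown seminorm can be absorbed, and `Φ` at
most triples (`IsYoungDelaySolution.growth_step`). The constant `c` turns the affine bound into a
multiplicative one.

With `N` greedy intervals and `M + 1` cells, the merged partition costs at most `3 ^ (N + M)`
(`le_three_pow_of_two_partitions`). Passing from the weight `ℓ ^ β` back to `r ^ β` costs `M + 1`,
and the product is below the stated exponential. The bound on `N` holds because a greedy interval
ending before the endpoint uses up the full threshold `μ`, so its length is bounded below. -/

theorem IsHolderOn.exists_norm_sub_le (hα : 0 ≤ α) (hh : IsHolderOn α h (Icc a b)) :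
    ∃ C : ℝ, 0 ≤ C ∧ ∀ s t, a ≤ s → s ≤ t → t ≤ b → ‖h t - h s‖ ≤ C * (t - s) ^ α := by
  obtain ⟨C, hC⟩ := hh
  refine ⟨C, C.2, fun s t hs hst ht => ?_⟩
  have := hC.dist_le (x := t) ⟨hs.trans hst, ht⟩ (y := s) ⟨hs, hst.trans ht⟩
  rwa [dist_eq_norm, Real.dist_eq, abs_of_nonneg (sub_nonneg.2 hst), Real.coe_toNNReal _ hα] at this

theorem IsHolderOn.of_norm_sub_le (hα : 0 ≤ α) {C : ℝ} (hC : 0 ≤ C)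
    (hh : ∀ s t, a ≤ s → s ≤ t → t ≤ b → ‖h t - h s‖ ≤ C * (t - s) ^ α) :
    IsHolderOn α h (Icc a b) := by
  refine ⟨C.toNNReal, fun s hs t ht => ?_⟩
  have key : dist (h s) (h t) ≤ C * dist s t ^ α := by
    rcases le_total s t with hst | hst
    · rw [dist_comm, dist_eq_norm, dist_comm, Real.dist_eq, abs_of_nonneg (sub_nonneg.2 hst)]
      exact hh s t hs.1 hst ht.2
    · rw [dist_eq_norm, Real.dist_eq, abs_of_nonneg (sub_nonneg.2 hst)]
      exact hh t s ht.1 hst hs.2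
  rw [edist_dist, edist_dist, Real.coe_toNNReal _ hα,
    ENNReal.ofReal_rpow_of_nonneg dist_nonneg hα, show ((C.toNNReal : ℝ≥0) : ENNReal) = ENNReal.ofReal C from rfl,
    ← ENNReal.ofReal_mul hC]
  exact ENNReal.ofReal_le_ofReal key

theorem IsHolderOn.mono {s t : Set ℝ} (hh : IsHolderOn α h t) (hst : s ⊆ t) : IsHolderOn α h s :=
  hh.imp fun _ hC => HolderOnWith.mono hC hst

theorem IsHolderOn.continuousOn {s : Set ℝ} (hα : 0 < α) (hh : IsHolderOn α h s) :
    ContinuousOn h s := by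
  obtain ⟨C, hC⟩ := hh
  exact hC.continuousOn (Real.toNNReal_pos.2 hα)

theorem holderSeminorm_nonneg : 0 ≤ holderSeminorm α h a b := by
  apply Real.sSup_nonneg
  rintro z ⟨s, t, -, hst, -, rfl⟩
  have := sub_pos.2 hst
  positivity

theorem holderSeminorm_le {C : ℝ} (hC : 0 ≤ C)
    (hh : ∀ s t, a ≤ s → s < t → t ≤ b → ‖h t - h s‖ ≤ C * (t - s) ^ α) :
    holderSeminorm α h a b ≤ C := by
  apply Real.sSup_le _ hC
  rintro z ⟨s, t, hs, hst, ht, rfl⟩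
  rw [div_le_iff₀ (Real.rpow_pos_of_pos (sub_pos.2 hst) _)]
  exact hh s t hs hst ht

theorem norm_sub_le_holderSeminorm (hα : 0 ≤ α) (hh : IsHolderOn α h (Icc a b)) {s t : ℝ}
    (hs : a ≤ s) (hst : s ≤ t) (ht : t ≤ b) :
    ‖h t - h s‖ ≤ holderSeminorm α h a b * (t - s) ^ α := by
  rcases hst.eq_or_lt with rfl | hst
  · simpa using mul_nonneg holderSeminorm_nonneg (Real.rpow_nonneg le_rfl α)
  obtain ⟨C, hC, hb⟩ := hh.exists_norm_sub_le hα
  rw [← div_le_iff₀ (Real.rpow_pos_of_pos (sub_pos.2 hst) _)]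
  -- Boundedness is essential: the real supremum of an unbounded set is `0`.
  refine le_csSup ⟨C, ?_⟩ ⟨s, t, hs, hst, ht, rfl⟩
  rintro z ⟨s, t, hs, hst, ht, rfl⟩
  rw [div_le_iff₀ (Real.rpow_pos_of_pos (sub_pos.2 hst) _)]
  exact hb s t hs hst.le ht

theorem holderSeminorm_mono (hα : 0 ≤ α) (hh : IsHolderOn α h (Icc a b)) {a' b' : ℝ}
    (ha : a ≤ a') (hb : b' ≤ b) : holderSeminorm α h a' b' ≤ holderSeminorm α h a b :=
  holderSeminorm_le holderSeminorm_nonneg fun _ _ hs hst ht =>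
    norm_sub_le_holderSeminorm hα hh (ha.trans hs) hst.le (ht.trans hb)

/-- An increment across `p` splits in two, and each partial length is at most `t - s`. -/
theorem holderSeminorm_le_add (hα : 0 ≤ α) (hh : IsHolderOn α h (Icc a b)) {p : ℝ}
    (hap : a ≤ p) (hpb : p ≤ b) :
    holderSeminorm α h a b ≤ holderSeminorm α h a p + holderSeminorm α h p b := by
  have h1 := holderSeminorm_nonneg (α := α) (h := h) (a := a) (b := p)
  have h2 := holderSeminorm_nonneg (α := α) (h := h) (a := p) (b := b)
  refine holderSeminorm_le (by positivity) fun s t hs hst ht => ?_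
  have hα' := Real.rpow_nonneg (sub_nonneg.2 hst.le) α
  have e1 := hh.mono (Icc_subset_Icc_right hpb)
  have e2 := hh.mono (Icc_subset_Icc_left hap)
  rcases le_total t p with htp | htp
  · nlinarith [norm_sub_le_holderSeminorm hα e1 hs hst.le htp]
  rcases le_total p s with hps | hps
  · nlinarith [norm_sub_le_holderSeminorm hα e2 hps hst.le ht]
  calc ‖h t - h s‖ ≤ ‖h p - h s‖ + ‖h t - h p‖ := by
        rw [add_comm]; exact norm_sub_le_norm_sub_add_norm_sub _ _ _
    _ ≤ holderSeminorm α h a p * (t - s) ^ α + holderSeminorm α h p b * (t - s) ^ α := by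
        gcongr
        · refine (norm_sub_le_holderSeminorm hα e1 hs hps le_rfl).trans ?_
          gcongr
        · refine (norm_sub_le_holderSeminorm hα e2 le_rfl htp ht).trans ?_
          gcongr
    _ = _ := by ring

theorem supNormOn_nonneg : 0 ≤ supNormOn h a b := by
  apply Real.sSup_nonneg
  rintro z ⟨s, -, rfl⟩
  positivity

theorem supNormOn_le {C : ℝ} (hC : 0 ≤ C) (hh : ∀ t, a ≤ t → t ≤ b → ‖h t‖ ≤ C) :
    supNormOn h a b ≤ C := by
  apply Real.sSup_le _ hC
  rintro z ⟨s, hs, rfl⟩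
  exact hh s hs.1 hs.2

theorem norm_le_supNormOn (hh : ContinuousOn h (Icc a b)) {t : ℝ} (hs : a ≤ t) (ht : t ≤ b) :
    ‖h t‖ ≤ supNormOn h a b :=
  le_csSup (isCompact_Icc.bddAbove_image hh.norm) ⟨t, ⟨hs, ht⟩, rfl⟩

theorem supNormOn_mono (hh : ContinuousOn h (Icc a b)) {a' b' : ℝ}
    (ha : a ≤ a') (hb : b' ≤ b) : supNormOn h a' b' ≤ supNormOn h a b :=
  supNormOn_le supNormOn_nonneg fun _ hs ht => norm_le_supNormOn hh (ha.trans hs) (ht.trans hb)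

end HolderNorm

/-! ### Young integrals and the Young-Loève estimate. -/

section Young

variable {E F : Type*} [NormedAddCommGroup E] [NormedSpace ℝ E]
  [NormedAddCommGroup F] [NormedSpace ℝ F] {G : ℝ → E →L[ℝ] F} {x : ℝ → E} {a b c : ℝ}

theorem HasYoungIntegral.sub {I₁ I₂ : F} (hab : a ≤ b)
    (h₁ : HasYoungIntegral G x a b I₁) (h₂ : HasYoungIntegral G x a c I₂) :
    HasYoungIntegral G x b c (I₂ - I₁) := by
  intro ε hε
  obtain ⟨δ₁, hδ₁, H₁⟩ := h₁ (ε / 2) (half_pos hε)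
  obtain ⟨δ₂, hδ₂, H₂⟩ := h₂ (ε / 2) (half_pos hε)
  refine ⟨δ₂, hδ₂, fun N p ξ hp0 hpN hp => ?_⟩
  -- A uniform partition of `[a, b]`, finer than both meshes, is placed before the given partition
  -- of `[b, c]`. The difference of the two sums is then exactly the sum over `[b, c]`.
  obtain ⟨M, hM⟩ := exists_nat_gt ((b - a) / min δ₁ δ₂)
  have hδ : 0 < min δ₁ δ₂ := lt_min hδ₁ hδ₂
  have hM0 : (0 : ℝ) < M := lt_of_le_of_lt (div_nonneg (sub_nonneg.2 hab) hδ.le) hM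
  have hmesh : (b - a) / M < min δ₁ δ₂ := by
    rw [div_lt_iff₀ hδ] at hM
    rw [div_lt_iff₀ hM0]
    linarith
  have hw : 0 ≤ (b - a) / M := div_nonneg (sub_nonneg.2 hab) hM0.le
  let q : ℕ → ℝ := fun i => a + i * ((b - a) / M)
  have hq0 : q 0 = a := by simp [q]
  have hqM : q M = b := by simp only [q]; field_simp; ring
  have hqs : ∀ i, q (i + 1) = q i + (b - a) / M := fun i => by simp only [q]; push_cast; ring
  have k₁ := H₁ M q q hq0 hqM fun i _ => by
    rw [hqs]
    exact ⟨by linarith, by linarith [min_le_left δ₁ δ₂], ⟨le_rfl, by linarith⟩⟩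
  let P : ℕ → ℝ := fun i => if i < M then q i else p (i - M)
  let Ξ : ℕ → ℝ := fun i => if i < M then q i else ξ (i - M)
  have hPq : ∀ i ≤ M, P i = q i := fun i hi => by
    rcases hi.eq_or_lt with rfl | hi
    · simp [P, hp0, hqM]
    · simp [P, hi]
  have hPp : ∀ i, P (M + i) = p i := fun i => by simp [P]
  have hΞp : ∀ i, Ξ (M + i) = ξ i := fun i => by simp [Ξ]
  have hΞq : ∀ i < M, Ξ i = q i := fun i hi => by simp [Ξ, hi]
  have k₂ := H₂ (M + N) P Ξ (by rw [hPq 0 (Nat.zero_le _), hq0]) (by rw [hPp, hpN]) fun i hi => by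
    by_cases hiM : i < M
    · rw [hPq i hiM.le, hPq (i + 1) hiM, hΞq i hiM, hqs]
      exact ⟨by linarith, by linarith [min_le_right δ₁ δ₂], ⟨le_rfl, by linarith⟩⟩
    · obtain ⟨j, rfl⟩ := Nat.exists_eq_add_of_le (not_lt.1 hiM)
      rw [add_assoc, hPp, hPp, hΞp]
      exact hp j (by omega)
  rw [Finset.sum_range_add] at k₂
  have e₁ : ∑ i ∈ Finset.range M, G (Ξ i) (x (P (i + 1)) - x (P i)) =
      ∑ i ∈ Finset.range M, G (q i) (x (q (i + 1)) - x (q i)) :=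
    Finset.sum_congr rfl fun i hi => by
      have hi := Finset.mem_range.1 hi
      rw [hPq i hi.le, hPq (i + 1) hi, hΞq i hi]
  simp only [add_assoc, hPp, hΞp] at k₂
  rw [e₁] at k₂
  refine lt_of_le_of_lt ?_ ((add_lt_add k₂ k₁).trans_eq (add_halves ε))
  refine le_trans (le_of_eq ?_) (norm_sub_le _ _)
  congr 1
  abel

/-- The left-point Riemann-Stieltjes sum over the dyadic partition of level `k`. -/
noncomputable def dyadicSum (G : ℝ → E →L[ℝ] F) (x : ℝ → E) (a b : ℝ) (k : ℕ) : F :=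
  ∑ i ∈ Finset.range (2 ^ k), G (a + i * ((b - a) / 2 ^ k))
    (x (a + (i + 1 : ℕ) * ((b - a) / 2 ^ k)) - x (a + i * ((b - a) / 2 ^ k)))

theorem HasYoungIntegral.tendsto_dyadicSum {I : F} (hab : a ≤ b) (h : HasYoungIntegral G x a b I) :
    Filter.Tendsto (dyadicSum G x a b) Filter.atTop (nhds I) := by
  rw [Metric.tendsto_atTop]
  intro ε hε
  obtain ⟨δ, hδ, H⟩ := h ε hε
  have hlim : Filter.Tendsto (fun k : ℕ => (b - a) * (1 / 2 : ℝ) ^ k) Filter.atTop (nhds 0) := by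
    simpa using (tendsto_pow_atTop_nhds_zero_of_lt_one (r := (1 / 2 : ℝ)) (by norm_num)
      (by norm_num)).const_mul (b - a)
  obtain ⟨k₀, hk₀⟩ := Filter.eventually_atTop.1 (hlim.eventually (gt_mem_nhds hδ))
  refine ⟨k₀, fun k hk => ?_⟩
  have hw : 0 ≤ (b - a) / 2 ^ k := div_nonneg (sub_nonneg.2 hab) (by positivity)
  have hmesh : (b - a) / 2 ^ k < δ := by
    have := hk₀ k hk
    rwa [one_div, inv_pow, ← div_eq_mul_inv] at this
  rw [dist_eq_norm]
  refine H (2 ^ k) (fun i => a + i * ((b - a) / 2 ^ k)) (fun i => a + i * ((b - a) / 2 ^ k))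
    (by simp) (by push_cast; field_simp; ring) fun i _ => ?_
  push_cast
  exact ⟨by linarith, by linarith, le_rfl, by linarith⟩

theorem Finset.sum_range_two_mul {M : Type*} [AddCommMonoid M] (u : ℕ → M) (n : ℕ) :
    ∑ i ∈ Finset.range (2 * n), u i = ∑ i ∈ Finset.range n, (u (2 * i) + u (2 * i + 1)) := by
  induction n with
  | zero => simp
  | succ n ih =>
    rw [Finset.sum_range_succ, ← ih, mul_add, mul_one, Finset.sum_range_succ,
      Finset.sum_range_succ, add_assoc]

variable {α ν CG Cx : ℝ}

/-- Halving a cell changes its term by the increment of `G` on the left half applied to the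
increment of `x` on the right half. -/
theorem norm_dyadicSum_succ_sub_le (hab : a ≤ b) (hCG : 0 ≤ CG)
    (hG : ∀ s t, a ≤ s → s ≤ t → t ≤ b → ‖G t - G s‖ ≤ CG * (t - s) ^ α)
    (hx : ∀ s t, a ≤ s → s ≤ t → t ≤ b → ‖x t - x s‖ ≤ Cx * (t - s) ^ ν) (k : ℕ) :
    ‖dyadicSum G x a b (k + 1) - dyadicSum G x a b k‖ ≤
      2 ^ k * (CG * ((b - a) / 2 ^ (k + 1)) ^ α * (Cx * ((b - a) / 2 ^ (k + 1)) ^ ν)) := by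
  set w := (b - a) / 2 ^ (k + 1) with hw
  have hw0 : 0 ≤ w := div_nonneg (sub_nonneg.2 hab) (by positivity)
  have hw2 : (b - a) / 2 ^ k = 2 * w := by rw [hw, pow_succ]; field_simp
  have hb : b = a + 2 ^ k * (2 * w) := by rw [← hw2]; field_simp; ring
  have e : dyadicSum G x a b (k + 1) - dyadicSum G x a b k =
      ∑ i ∈ Finset.range (2 ^ k), (G (a + (2 * i + 1) * w) - G (a + (2 * i) * w))
        (x (a + (2 * i + 2) * w) - x (a + (2 * i + 1) * w)) := by
    unfold dyadicSum
    rw [pow_succ' (2 : ℕ), Finset.sum_range_two_mul, ← Finset.sum_sub_distrib]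
    refine Finset.sum_congr rfl fun i _ => ?_
    rw [← hw, hw2]
    push_cast
    rw [show (i : ℝ) * (2 * w) = 2 * i * w by ring,
      show ((i : ℝ) + 1) * (2 * w) = (2 * i + 2) * w by ring,
      show (2 * (i : ℝ) + 1 + 1) = 2 * i + 2 by ring]
    simp only [Pi.sub_apply, map_sub]
    abel
  rw [e]
  refine (norm_sum_le_of_le _ (f := _) (n := fun _ => CG * w ^ α * (Cx * w ^ ν))
    fun i hi => ?_).trans_eq (by simp)
  have hi : ((i : ℝ) + 1) ≤ 2 ^ k := by exact_mod_cast Finset.mem_range.1 hi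
  have hi0 : (0 : ℝ) ≤ i := i.cast_nonneg
  have hend : a + (2 * i + 2) * w ≤ b := by rw [hb]; nlinarith
  have h1 := hG (a + (2 * i) * w) (a + (2 * i + 1) * w) (by nlinarith) (by nlinarith)
    (by nlinarith)
  have h2 := hx (a + (2 * i + 1) * w) (a + (2 * i + 2) * w) (by nlinarith) (by nlinarith) hend
  rw [show a + (2 * i + 1) * w - (a + (2 * i) * w) = w by ring] at h1
  rw [show a + (2 * i + 2) * w - (a + (2 * i + 1) * w) = w by ring] at h2
  refine (ContinuousLinearMap.le_opNorm _ _).trans ?_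
  have := Real.rpow_nonneg hw0 α
  gcongr

theorem two_rpow_lt_one (h : 1 < α + ν) : (2 : ℝ) ^ (1 - (α + ν)) < 1 :=
  Real.rpow_lt_one_of_one_lt_of_neg (by norm_num) (by linarith)

/-- The Young-Loève estimate. -/
theorem HasYoungIntegral.norm_sub_le {I : F} (h : HasYoungIntegral G x a b I) (hab : a ≤ b)
    (hθ : 1 < α + ν) (hα : 0 ≤ α) (hν : 0 ≤ ν) (hCG : 0 ≤ CG) (hCx : 0 ≤ Cx)
    (hG : ∀ s t, a ≤ s → s ≤ t → t ≤ b → ‖G t - G s‖ ≤ CG * (t - s) ^ α)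
    (hx : ∀ s t, a ≤ s → s ≤ t → t ≤ b → ‖x t - x s‖ ≤ Cx * (t - s) ^ ν) :
    ‖I - G a (x b - x a)‖ ≤ youngConst α ν / 2 * (CG * Cx * (b - a) ^ (α + ν)) := by
  set ρ : ℝ := 2 ^ (1 - (α + ν)) with hρ
  have hρ0 : 0 < ρ := by positivity
  have hρ1 : ρ < 1 := two_rpow_lt_one hθ
  have hD : 0 ≤ b - a := sub_nonneg.2 hab
  set B := CG * Cx * (b - a) ^ (α + ν) with hB
  have hB0 : 0 ≤ B := by positivity
  have step : ∀ k, dist (dyadicSum G x a b k) (dyadicSum G x a b (k + 1)) ≤ B / 2 * ρ ^ k := by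
    intro k
    rw [dist_comm, dist_eq_norm]
    refine (norm_dyadicSum_succ_sub_le hab hCG hG hx k).trans ?_
    have e : (2 : ℝ) ^ k * (CG * ((b - a) / 2 ^ (k + 1)) ^ α * (Cx * ((b - a) / 2 ^ (k + 1)) ^ ν))
        = B * (2 ^ k / ((2 : ℝ) ^ (k + 1)) ^ (α + ν)) := by
      rw [Real.div_rpow hD (by positivity), Real.div_rpow hD (by positivity),
        Real.rpow_add (by positivity), hB, Real.rpow_add_of_nonneg hD hα hν]
      field_simp
    rw [e]
    have e2 : (2 : ℝ) ^ k / ((2 : ℝ) ^ (k + 1)) ^ (α + ν) = ρ ^ k * 2 ^ (-(α + ν)) := by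
      rw [hρ, ← Real.rpow_natCast, ← Real.rpow_natCast, ← Real.rpow_natCast,
        ← Real.rpow_mul (by norm_num), ← Real.rpow_mul (by norm_num),
        ← Real.rpow_sub (by norm_num), ← Real.rpow_add (by norm_num)]
      congr 1
      push_cast
      ring
    -- This factor supplies the `1 / 2` in `youngConst α ν / 2`; the geometric series in `ρ`
    -- supplies the rest.
    have e3 : (2 : ℝ) ^ (-(α + ν)) ≤ 1 / 2 := by
      rw [show (1 / 2 : ℝ) = 2 ^ (-1 : ℝ) by rw [Real.rpow_neg_one]; norm_num]
      exact Real.rpow_le_rpow_of_exponent_le (by norm_num) (by linarith)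
    rw [e2]
    nlinarith [mul_le_mul_of_nonneg_left e3 (mul_nonneg hB0 (pow_nonneg hρ0.le k))]
  have := dist_le_of_le_geometric_of_tendsto₀ ρ (B / 2) hρ1 step (h.tendsto_dyadicSum hab)
  rw [dist_comm, dist_eq_norm] at this
  have e0 : dyadicSum G x a b 0 = G a (x b - x a) := by simp [dyadicSum]
  rw [e0] at this
  refine this.trans_eq ?_
  rw [youngConst, ← hρ]
  ring

theorem two_le_youngConst (h : 1 < α + ν) (h2 : α + ν ≤ 2) : 2 ≤ youngConst α ν := by
  have h1 := two_rpow_lt_one h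
  have h3 : (1 / 2 : ℝ) ≤ 2 ^ (1 - (α + ν)) := by
    rw [show (1 / 2 : ℝ) = 2 ^ (-1 : ℝ) by rw [Real.rpow_neg_one]; norm_num]
    exact Real.rpow_le_rpow_of_exponent_le (by norm_num) (by linarith)
  rw [youngConst, le_div_iff₀ (by linarith)]
  linarith

end Young

/-! ### Greedy times and their number. -/

section Greedy

variable {E : Type*} [NormedAddCommGroup E] {μ ν β : ℝ} {x : ℝ → E} {a b : ℝ}

theorem mem_greedyTime_set (hμ : 0 ≤ μ) (hγ : β < ν) {i : ℕ}
    (hi : greedyTime μ ν β x a b i ≤ b) :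
    greedyTime μ ν β x a b i ∈ {t : ℝ | t ∈ Icc (greedyTime μ ν β x a b i) b ∧
      (t - greedyTime μ ν β x a b i) ^ (ν - β) *
        holderSeminorm ν x (greedyTime μ ν β x a b i) t ≤ μ} := by
  refine ⟨⟨le_rfl, hi⟩, ?_⟩
  rw [sub_self, Real.zero_rpow (by linarith), zero_mul]
  exact hμ

theorem greedyTime_le (hμ : 0 ≤ μ) (hγ : β < ν) (hab : a ≤ b) (i : ℕ) :
    greedyTime μ ν β x a b i ≤ b := by
  induction i with
  | zero => exact hab
  | succ i ih => exact csSup_le ⟨_, mem_greedyTime_set hμ hγ ih⟩ fun t ht => ht.1.2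

theorem greedyTime_le_succ (hμ : 0 ≤ μ) (hγ : β < ν) (hab : a ≤ b) (i : ℕ) :
    greedyTime μ ν β x a b i ≤ greedyTime μ ν β x a b (i + 1) :=
  le_csSup ⟨b, fun _ ht => ht.1.2⟩ (mem_greedyTime_set hμ hγ (greedyTime_le hμ hγ hab i))

theorem greedyTime_monotone (hμ : 0 ≤ μ) (hγ : β < ν) (hab : a ≤ b) :
    Monotone (greedyTime μ ν β x a b) :=
  monotone_nat_of_le_succ (greedyTime_le_succ hμ hγ hab)

theorem le_greedyTime (hμ : 0 ≤ μ) (hγ : β < ν) (hab : a ≤ b) (i : ℕ) :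
    a ≤ greedyTime μ ν β x a b i :=
  greedyTime_monotone hμ hγ hab (Nat.zero_le i)

/-- The threshold condition survives at the supremum `t_{i+1}` itself. In terms of single increments
it passes to the limit by continuity of `x`. -/
theorem norm_sub_le_of_greedyTime (hμ : 0 ≤ μ) (hν : 0 < ν) (hγ : β < ν) (hab : a ≤ b)
    (hx : IsHolderOn ν x (Icc a b)) (i : ℕ) {s t : ℝ} (hs : greedyTime μ ν β x a b i ≤ s)
    (hst : s ≤ t) (ht : t ≤ greedyTime μ ν β x a b (i + 1)) :
    (greedyTime μ ν β x a b (i + 1) - greedyTime μ ν β x a b i) ^ (ν - β) * ‖x t - x s‖ ≤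
      μ * (t - s) ^ ν := by
  rcases hst.eq_or_lt with rfl | hst
  · simpa using mul_nonneg hμ (Real.rpow_nonneg le_rfl ν)
  set p := greedyTime μ ν β x a b i with hp
  set q := greedyTime μ ν β x a b (i + 1) with hq
  have hap : a ≤ p := le_greedyTime hμ hγ hab i
  have hqb : q ≤ b := greedyTime_le hμ hγ hab (i + 1)
  have key : ∀ δ ∈ Ioo 0 (t - s),
      (q - δ - p) ^ (ν - β) * ‖x (t - δ) - x s‖ ≤ μ * (t - δ - s) ^ ν := by
    intro δ hδ
    -- Some admissible time `u` lies beyond `q - δ`, so the condition is available up to `t - δ`;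
    -- then `δ` tends to `0`.
    obtain ⟨u, ⟨hu, hu'⟩, hlt⟩ := exists_lt_of_lt_csSup
      ⟨_, mem_greedyTime_set hμ hγ (greedyTime_le (x := x) hμ hγ hab i)⟩
      (show q - δ < q by linarith [hδ.1])
    rw [← hp] at hu hu'
    have hxu := hx.mono (Icc_subset_Icc hap hu.2)
    have h1 := norm_sub_le_holderSeminorm hν.le hxu hs (by linarith [hδ.2] : s ≤ t - δ)
      (by linarith)
    have h2 : (q - δ - p) ^ (ν - β) ≤ (u - p) ^ (ν - β) :=
      Real.rpow_le_rpow (by linarith [hδ.2]) (by linarith) (by linarith)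
    have h3 : 0 ≤ (u - p) ^ (ν - β) := Real.rpow_nonneg (by linarith [hu.1]) _
    have h4 : 0 ≤ (t - δ - s) ^ ν := Real.rpow_nonneg (by linarith [hδ.2]) _
    calc _ ≤ (u - p) ^ (ν - β) * (holderSeminorm ν x p u * (t - δ - s) ^ ν) := by gcongr
      _ = ((u - p) ^ (ν - β) * holderSeminorm ν x p u) * (t - δ - s) ^ ν := by ring
      _ ≤ _ := by gcongr
  have hev : ∀ᶠ δ in nhdsWithin (0 : ℝ) (Ioi 0), δ ∈ Ioo 0 (t - s) :=
    Ioo_mem_nhdsGT (sub_pos.2 hst)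
  have l0 : Filter.Tendsto (fun δ : ℝ => δ) (nhdsWithin 0 (Ioi 0)) (nhds 0) :=
    Filter.tendsto_id.mono_left nhdsWithin_le_nhds
  have lx : Filter.Tendsto (fun δ => x (t - δ)) (nhdsWithin 0 (Ioi 0)) (nhds (x t)) := by
    refine (hx.continuousOn hν t ⟨by linarith, by linarith⟩).tendsto.comp
      (tendsto_nhdsWithin_iff.2 ⟨by simpa using l0.const_sub t, ?_⟩)
    filter_upwards [hev] with δ hδ
    exact ⟨by linarith [hδ.2], by linarith [hδ.1]⟩
  have l1 : Filter.Tendsto (fun δ => (q - δ - p) ^ (ν - β) * ‖x (t - δ) - x s‖)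
      (nhdsWithin 0 (Ioi 0)) (nhds ((q - p) ^ (ν - β) * ‖x t - x s‖)) := by
    refine Filter.Tendsto.mul ?_ (lx.sub_const _).norm
    refine Filter.Tendsto.rpow_const ?_ (Or.inr (by linarith))
    simpa using (l0.const_sub q).sub_const p
  have l2 : Filter.Tendsto (fun δ => μ * (t - δ - s) ^ ν)
      (nhdsWithin 0 (Ioi 0)) (nhds (μ * (t - s) ^ ν)) := by
    refine Filter.Tendsto.const_mul _ (Filter.Tendsto.rpow_const ?_ (Or.inr hν.le))
    simpa using (l0.const_sub t).sub_const s
  exact le_of_tendsto_of_tendsto l1 l2 (hev.mono key)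

/-- Every time in `(t_{i+1}, b)` violates the threshold; let it decrease to `t_{i+1}`. -/
theorem le_mul_holderSeminorm_of_greedyTime_lt (hμ : 0 ≤ μ) (hν : 0 < ν) (hγ : β < ν) (hab : a ≤ b)
    (hx : IsHolderOn ν x (Icc a b)) {i : ℕ} (hi : greedyTime μ ν β x a b (i + 1) < b) :
    μ ≤ (greedyTime μ ν β x a b (i + 1) - greedyTime μ ν β x a b i) ^ (ν - β) *
      holderSeminorm ν x a b := by
  set p := greedyTime μ ν β x a b i with hp
  set q := greedyTime μ ν β x a b (i + 1) with hq
  have hap : a ≤ p := le_greedyTime hμ hγ hab i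
  have hpq : p ≤ q := greedyTime_le_succ hμ hγ hab i
  have key : ∀ t ∈ Ioo q b, μ ≤ (t - p) ^ (ν - β) * holderSeminorm ν x a b := by
    intro t ht
    by_contra! hlt
    refine ht.1.not_ge (le_csSup ⟨b, fun _ ht => ht.1.2⟩ ⟨⟨hpq.trans ht.1.le, ht.2.le⟩, ?_⟩)
    refine le_trans ?_ hlt.le
    have : 0 ≤ (t - p) ^ (ν - β) := Real.rpow_nonneg (by linarith [ht.1]) _
    gcongr
    exact holderSeminorm_mono hν.le hx hap ht.2.le
  have hev : ∀ᶠ t in nhdsWithin q (Ioi q), t ∈ Ioo q b := Ioo_mem_nhdsGT hi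
  refine ge_of_tendsto ?_ (hev.mono key)
  refine Filter.Tendsto.mul_const _ (Filter.Tendsto.rpow_const ?_ (Or.inr (by linarith)))
  exact (Filter.tendsto_id.mono_left nhdsWithin_le_nhds).sub_const p

/-- Each completed gap, multiplied by `(|||x||| / μ) ^ (1 / (ν - β))`, is at least `1`, and the gaps
telescope. The product form avoids dividing by a seminorm that may vanish. -/
theorem natCast_le_of_greedyTime_lt (hμ : 0 < μ) (hν : 0 < ν) (hγ : β < ν) (hab : a ≤ b)
    (hx : IsHolderOn ν x (Icc a b)) {i : ℕ} (hi : greedyTime μ ν β x a b i < b) :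
    (i : ℝ) ≤ (greedyTime μ ν β x a b i - a) *
      (holderSeminorm ν x a b / μ) ^ (1 / (ν - β)) := by
  induction i with
  | zero => simp [greedyTime]
  | succ i ih =>
    have hle := greedyTime_le_succ (x := x) hμ.le hγ hab i
    have h1 := ih (hle.trans_lt hi)
    have h2 := le_mul_holderSeminorm_of_greedyTime_lt hμ.le hν hγ hab hx hi
    have hX : 0 ≤ holderSeminorm ν x a b / μ := div_nonneg holderSeminorm_nonneg hμ.le
    have hγ' : 0 < ν - β := sub_pos.2 hγ
    have hd := sub_nonneg.2 hle
    have h3 : 1 ≤ (greedyTime μ ν β x a b (i + 1) - greedyTime μ ν β x a b i) ^ (ν - β) *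
        (holderSeminorm ν x a b / μ) := by
      rw [← mul_div_assoc, le_div_iff₀ hμ]
      linarith
    have h4 := Real.one_le_rpow h3 (one_div_pos.2 hγ').le
    rw [Real.mul_rpow (Real.rpow_nonneg hd _) hX, ← Real.rpow_mul hd, mul_one_div_cancel hγ'.ne',
      Real.rpow_one] at h4
    push_cast
    linarith

theorem bddAbove_greedyIndices (hμ : 0 < μ) (hν : 0 < ν) (hγ : β < ν) (hab : a ≤ b)
    (hx : IsHolderOn ν x (Icc a b)) : BddAbove (greedyIndices μ ν β x a b) := by
  refine ⟨⌊(b - a) * (holderSeminorm ν x a b / μ) ^ (1 / (ν - β))⌋₊, fun i hi => Nat.le_floor ?_⟩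
  have hi : greedyTime μ ν β x a b i < b := hi
  refine (natCast_le_of_greedyTime_lt hμ hν hγ hab hx hi).trans ?_
  have : 0 ≤ (holderSeminorm ν x a b / μ) ^ (1 / (ν - β)) :=
    Real.rpow_nonneg (div_nonneg holderSeminorm_nonneg hμ.le) _
  gcongr

theorem greedyTime_greedyCount (hμ : 0 < μ) (hν : 0 < ν) (hγ : β < ν) (hab : a ≤ b)
    (hx : IsHolderOn ν x (Icc a b)) :
    greedyTime μ ν β x a b (greedyCount μ ν β x a b) = b := by
  refine (greedyTime_le hμ.le hγ hab _).antisymm (not_lt.1 fun hlt => ?_)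
  have := le_csSup (bddAbove_greedyIndices hμ hν hγ hab hx)
    (show greedyCount μ ν β x a b ∈ greedyIndices μ ν β x a b from hlt)
  rw [greedyCount] at this
  omega

theorem greedyCount_le (hμ : 0 < μ) (hν : 0 < ν) (hγ : β < ν) (hab : a < b)
    (hx : IsHolderOn ν x (Icc a b)) :
    (greedyCount μ ν β x a b : ℝ) ≤
      1 + (b - a) * (holderSeminorm ν x a b / μ) ^ (1 / (ν - β)) := by
  have hmem : sSup (greedyIndices μ ν β x a b) ∈ greedyIndices μ ν β x a b :=
    Nat.sSup_mem ⟨0, hab⟩ (bddAbove_greedyIndices hμ hν hγ hab.le hx)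
  have hlt : greedyTime μ ν β x a b (sSup (greedyIndices μ ν β x a b)) < b := hmem
  have h1 := natCast_le_of_greedyTime_lt hμ hν hγ hab.le hx hlt
  have : 0 ≤ (holderSeminorm ν x a b / μ) ^ (1 / (ν - β)) :=
    Real.rpow_nonneg (div_nonneg holderSeminorm_nonneg hμ.le) _
  rw [greedyCount]
  push_cast
  nlinarith

end Greedy

/-- If a quantity grows at most by the factor `3` over every interval contained in an interval
of each of two partitions, then it grows at most by the factor `3 ^ (i + j + 1)` up to a point
lying in the interval `i` of the first and in the interval `j` of the second partition. -/
theorem le_three_pow_of_two_partitions {Φ : ℝ → ℝ} {σ τ : ℕ → ℝ} {a : ℝ} (hΦ : 0 ≤ Φ a)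
    (hσ : Monotone σ) (hτ : Monotone τ) (hσ0 : σ 0 = a) (hτ0 : τ 0 = a)
    (step : ∀ i j p q, σ i ≤ p → τ j ≤ p → p ≤ q → q ≤ σ (i + 1) → q ≤ τ (j + 1) →
      Φ q ≤ 3 * Φ p) (k : ℕ) :
    ∀ i j t, i + j = k → σ i ≤ t → t ≤ σ (i + 1) → τ j ≤ t → t ≤ τ (j + 1) →
      Φ t ≤ 3 ^ (k + 1) * Φ a := by
  -- If both current cells already contain `a`, one step suffices.
  have first : ∀ i j t k, σ i ≤ t → t ≤ σ (i + 1) → τ j ≤ t → t ≤ τ (j + 1) →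
      σ i ≤ a → τ j ≤ a → a ≤ t → Φ t ≤ 3 ^ (k + 1) * Φ a := by
    intro i j t k _ h2 _ h4 h5 h6 h7
    refine (step i j a t h5 h6 h7 h2 h4).trans ?_
    gcongr
    exact le_self_pow₀ (by norm_num) (Nat.succ_ne_zero k)
  induction k with
  | zero =>
    intro i j t hij h1 h2 h3 h4
    obtain ⟨rfl, rfl⟩ : i = 0 ∧ j = 0 := by omega
    exact first 0 0 t 0 h1 h2 h3 h4 hσ0.le hτ0.le (hσ0 ▸ h1)
  | succ k ih =>
    intro i j t hij h1 h2 h3 h4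
    have hai : a ≤ σ i := hσ0 ▸ hσ (Nat.zero_le i)
    have haj : a ≤ τ j := hτ0 ▸ hτ (Nat.zero_le j)
    -- Go back to the later of the two left endpoints: it is also the right endpoint of the
    -- preceding cell of its partition, so `i + j` drops by one.
    rcases le_total (τ j) (σ i) with hle | hle
    · rcases i with _ | i
      · rw [hσ0] at hle
        exact first 0 j t _ h1 h2 h3 h4 hσ0.le hle (hσ0 ▸ h1)
      · have := ih i j (σ (i + 1)) (by omega) (hσ (Nat.le_succ i)) le_rfl hle (h1.trans h4)
        calc Φ t ≤ 3 * Φ (σ (i + 1)) := step _ _ _ _ le_rfl hle h1 h2 h4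
          _ ≤ 3 * (3 ^ (k + 1) * Φ a) := by gcongr
          _ = _ := by ring
    · rcases j with _ | j
      · rw [hτ0] at hle
        exact first i 0 t _ h1 h2 h3 h4 hle hτ0.le (hτ0 ▸ h3)
      · have := ih i j (τ (j + 1)) (by omega) hle (h3.trans h2) (hτ (Nat.le_succ j)) le_rfl
        calc Φ t ≤ 3 * Φ (τ (j + 1)) := step _ _ _ _ hle le_rfl h3 h2 h4
          _ ≤ 3 * (3 ^ (k + 1) * Φ a) := by gcongr
          _ = _ := by ring

/-! ### Delay segments, increments of solutions and their regularity. -/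

section Delay

variable {d m : ℕ} {r : ℝ} {y : ℝ → EuclideanSpace ℝ (Fin d)}

theorem delaySegment_apply {u : ℝ} (hy : ContinuousOn y (Icc (u - r) u))
    (s : Icc (-r) (0 : ℝ)) : delaySegment r y u s = y (u + s) := by
  have h : Continuous (fun s : Icc (-r) (0 : ℝ) => y (u + s)) := by
    refine hy.comp_continuous (by fun_prop) fun s => ?_
    exact ⟨by linarith [s.2.1], by linarith [s.2.2]⟩
  rw [delaySegment, dif_pos h]
  rfl

theorem norm_delaySegment_le {u S : ℝ} (hS : 0 ≤ S) (hy : ContinuousOn y (Icc (u - r) u))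
    (hb : ∀ v, u - r ≤ v → v ≤ u → ‖y v‖ ≤ S) : ‖delaySegment r y u‖ ≤ S := by
  rw [ContinuousMap.norm_le _ hS]
  intro s
  rw [delaySegment_apply hy]
  exact hb _ (by linarith [s.2.1]) (by linarith [s.2.2])

/-- At a fixed offset the two segments differ by an increment of `y` over a length `v - u`, so the
segment map inherits the Hölder constant. -/
theorem norm_delaySegment_sub_le {u v α H : ℝ} (hH : 0 ≤ H) (huv : u ≤ v)
    (hy : ContinuousOn y (Icc (u - r) v))
    (hb : ∀ s t, u - r ≤ s → s ≤ t → t ≤ v → ‖y t - y s‖ ≤ H * (t - s) ^ α) :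
    ‖delaySegment r y v - delaySegment r y u‖ ≤ H * (v - u) ^ α := by
  rw [ContinuousMap.norm_le _ (mul_nonneg hH (Real.rpow_nonneg (sub_nonneg.2 huv) _))]
  intro s
  rw [ContinuousMap.sub_apply,
    delaySegment_apply (hy.mono (Icc_subset_Icc (by linarith) le_rfl)),
    delaySegment_apply (hy.mono (Icc_subset_Icc le_rfl huv))]
  have := hb (u + s) (v + s) (by linarith [s.2.1]) (by linarith) (by linarith [s.2.2])
  rwa [show v + (s : ℝ) - (u + s) = v - u by ring] at this

variable {β₀ ν : ℝ} {A : Matrix (Fin d) (Fin d) ℝ}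
  {f : DelaySpace r d → EuclideanSpace ℝ (Fin d)} {Cf : ℝ≥0}
  {g : DelaySpace r d → EuclideanSpace ℝ (Fin m) →L[ℝ] EuclideanSpace ℝ (Fin d)} {Cg : ℝ}
  {x : ℝ → EuclideanSpace ℝ (Fin m)} {η : DelaySpace r d}

theorem IsYoungDelaySolution.continuousOn (hβ₀ : 0 < β₀) (hy : IsYoungDelaySolution r β₀ A f g x η y)
    (a T : ℝ) (ha : -r ≤ a) : ContinuousOn y (Icc a T) := by
  refine ((hy.holder (max T 1) (by positivity)).continuousOn hβ₀).mono ?_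
  exact Icc_subset_Icc ha (le_max_left _ _)

theorem IsYoungDelaySolution.continuousOn_drift (hr : 0 ≤ r) (hβ₀ : 0 < β₀)
    (hf : LipschitzWith Cf f) (hy : IsYoungDelaySolution r β₀ A f g x η y) (T : ℝ) :
    ContinuousOn (fun u => Matrix.toEuclideanCLM (𝕜 := ℝ) A (y u) + f (delaySegment r y u))
      (Icc 0 T) := by
  have hseg : IsHolderOn β₀ (delaySegment r y) (Icc 0 T) := by
    obtain ⟨C, hC, hb⟩ := (hy.holder (max T 1) (by positivity)).exists_norm_sub_le hβ₀.le
    refine IsHolderOn.of_norm_sub_le hβ₀.le hC fun s t hs hst ht => ?_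
    refine norm_delaySegment_sub_le hC hst (hy.continuousOn hβ₀ _ _ (by linarith)) ?_
    intro u v hu huv hv
    exact hb u v (by linarith) huv ((hv.trans ht).trans (le_max_left _ _))
  refine ContinuousOn.add ?_ (hf.continuous.comp_continuousOn (hseg.continuousOn hβ₀))
  exact (ContinuousLinearMap.continuous _).comp_continuousOn
    (hy.continuousOn hβ₀ 0 T (by linarith))

theorem IsYoungDelaySolution.exists_increment (hr : 0 ≤ r) (hβ₀ : 0 < β₀)
    (hf : LipschitzWith Cf f) (hy : IsYoungDelaySolution r β₀ A f g x η y) {s t : ℝ}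
    (hs : 0 ≤ s) (hst : s ≤ t) :
    ∃ I, HasYoungIntegral (fun u => g (delaySegment r y u)) x s t I ∧
      y t - y s = (∫ u in s..t,
        (Matrix.toEuclideanCLM (𝕜 := ℝ) A (y u) + f (delaySegment r y u))) + I := by
  obtain ⟨I₁, h₁, e₁⟩ := hy.equation s hs
  obtain ⟨I₂, h₂, e₂⟩ := hy.equation t (hs.trans hst)
  refine ⟨I₂ - I₁, h₁.sub hs h₂, ?_⟩
  have hc : ∀ T, 0 ≤ T → IntervalIntegrable (fun u =>
      Matrix.toEuclideanCLM (𝕜 := ℝ) A (y u) + f (delaySegment r y u)) MeasureTheory.volume 0 T :=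
    fun T hT => by
      apply ContinuousOn.intervalIntegrable
      rw [uIcc_of_le hT]
      exact hy.continuousOn_drift hr hβ₀ hf T
  rw [← intervalIntegral.integral_interval_sub_left (hc t (hs.trans hst)) (hc s hs), e₁, e₂]
  abel

theorem norm_drift_le (hf : LipschitzWith Cf f) {u S : ℝ} (hr : 0 ≤ r) (hS : 0 ≤ S)
    (hy : ContinuousOn y (Icc (u - r) u))
    (hb : ∀ v, u - r ≤ v → v ≤ u → ‖y v‖ ≤ S) :
    ‖Matrix.toEuclideanCLM (𝕜 := ℝ) A (y u) + f (delaySegment r y u)‖ ≤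
      ‖f 0‖ + (‖Matrix.toEuclideanCLM (𝕜 := ℝ) A‖ + Cf) * S := by
  have h1 : ‖Matrix.toEuclideanCLM (𝕜 := ℝ) A (y u)‖ ≤ ‖Matrix.toEuclideanCLM (𝕜 := ℝ) A‖ * S :=
    (ContinuousLinearMap.le_opNorm _ _).trans (by gcongr; exact hb u (by linarith) le_rfl)
  have h2 : ‖f (delaySegment r y u) - f 0‖ ≤ Cf * S := by
    refine (hf.norm_sub_le _ _).trans ?_
    rw [sub_zero]
    gcongr
    exact norm_delaySegment_le hS hy hb
  have h3 := norm_le_norm_add_norm_sub (f 0) (f (delaySegment r y u))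
  rw [norm_sub_rev] at h3
  linarith [norm_add_le (Matrix.toEuclideanCLM (𝕜 := ℝ) A (y u)) (f (delaySegment r y u))]

/-- The exponent `α` is left free: `β₀` serves to gain regularity, `β` to bound the growth. -/
theorem IsYoungDelaySolution.norm_sub_le (hr : 0 ≤ r) (hβ₀ : 0 < β₀)
    (hf : LipschitzWith Cf f) (hCg : 0 ≤ Cg) (hg : ∀ ξ ζ, ‖g ξ - g ζ‖ ≤ Cg * ‖ξ - ζ‖)
    (hy : IsYoungDelaySolution r β₀ A f g x η y)
    {s t α S H Cx : ℝ} (hs : 0 ≤ s) (hst : s ≤ t) (hα : 0 ≤ α) (hν : 0 ≤ ν) (hθ : 1 < α + ν)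
    (hS : 0 ≤ S) (hH : 0 ≤ H) (hCx : 0 ≤ Cx)
    (hyS : ∀ v, s - r ≤ v → v ≤ t → ‖y v‖ ≤ S)
    (hyH : ∀ u v, s - r ≤ u → u ≤ v → v ≤ t → ‖y v - y u‖ ≤ H * (v - u) ^ α)
    (hx : ∀ u v, s ≤ u → u ≤ v → v ≤ t → ‖x v - x u‖ ≤ Cx * (v - u) ^ ν) :
    ‖y t - y s‖ ≤ (t - s) * (‖f 0‖ + (‖Matrix.toEuclideanCLM (𝕜 := ℝ) A‖ + Cf) * S) +
      (‖g 0‖ + Cg * S) * (Cx * (t - s) ^ ν) +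
      youngConst α ν / 2 * (Cg * H * Cx * (t - s) ^ (α + ν)) := by
  obtain ⟨I, hI, e⟩ := hy.exists_increment hr hβ₀ hf hs hst
  have h1 : ‖∫ u in s..t, (Matrix.toEuclideanCLM (𝕜 := ℝ) A (y u) + f (delaySegment r y u))‖ ≤
      (‖f 0‖ + (‖Matrix.toEuclideanCLM (𝕜 := ℝ) A‖ + Cf) * S) * |t - s| := by
    refine intervalIntegral.norm_integral_le_of_norm_le_const fun u hu => ?_
    rw [uIoc_of_le hst] at hu
    refine norm_drift_le hf hr hS (hy.continuousOn hβ₀ _ _ (by linarith [hu.1])) fun v hv hvu => ?_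
    exact hyS v (by linarith [hu.1]) (hvu.trans hu.2)
  rw [abs_of_nonneg (sub_nonneg.2 hst)] at h1
  have h2 := hI.norm_sub_le (α := α) (ν := ν) hst hθ hα hν (mul_nonneg hCg hH) hCx
    (fun u v hu huv hv => by
      refine (hg _ _).trans ?_
      rw [mul_assoc]
      gcongr
      refine norm_delaySegment_sub_le hH huv (hy.continuousOn hβ₀ _ _ (by linarith)) ?_
      intro u' v' hu' huv' hv'
      exact hyH u' v' (by linarith) huv' (hv'.trans hv)) hx
  have h3 : ‖g (delaySegment r y s) (x t - x s)‖ ≤ (‖g 0‖ + Cg * S) * (Cx * (t - s) ^ ν) := by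
    refine (ContinuousLinearMap.le_opNorm _ _).trans ?_
    gcongr
    · have h4 := hg (delaySegment r y s) 0
      have h5 := norm_le_norm_add_norm_sub (g 0) (g (delaySegment r y s))
      rw [norm_sub_rev] at h5
      rw [sub_zero] at h4
      have h6 : ‖delaySegment r y s‖ ≤ S :=
        norm_delaySegment_le hS (hy.continuousOn hβ₀ _ _ (by linarith))
          fun v hv hvs => hyS v hv (hvs.trans hst)
      nlinarith
    · exact hx s t le_rfl hst le_rfl
  rw [e]
  have h7 := norm_add_le
    (∫ u in s..t, (Matrix.toEuclideanCLM (𝕜 := ℝ) A (y u) + f (delaySegment r y u))) I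
  have h8 := norm_le_norm_add_norm_sub (g (delaySegment r y s) (x t - x s)) I
  rw [norm_sub_rev] at h8
  linarith

/-- The increment estimate with `α = β₀` has the exponents `1`, `ν` and `β₀ + ν`, all at least `β`.
The interval starts at `0` because the initial segment is only `β₀`-Hölder. -/
theorem IsYoungDelaySolution.isHolderOn (hr : 0 ≤ r) (hβ₀ : 0 < β₀)
    (hf : LipschitzWith Cf f) (hCg : 0 ≤ Cg) (hg : ∀ ξ ζ, ‖g ξ - g ζ‖ ≤ Cg * ‖ξ - ζ‖)
    (hy : IsYoungDelaySolution r β₀ A f g x η y)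
    {T β : ℝ} (hT : 0 < T) (hν : 0 ≤ ν) (hθ : 1 < β₀ + ν) (hβ : 0 ≤ β) (hβ1 : β ≤ 1) (hβν : β ≤ ν)
    (hx : IsHolderOn ν x (Icc 0 T)) : IsHolderOn β y (Icc 0 T) := by
  obtain ⟨H, hH, hyH⟩ := (hy.holder T hT).exists_norm_sub_le hβ₀.le
  obtain ⟨Cx, hCx, hxC⟩ := hx.exists_norm_sub_le hν
  set S := supNormOn y (-r) T
  have hS : 0 ≤ S := supNormOn_nonneg
  have hK : 0 ≤ youngConst β₀ ν := by
    rw [youngConst]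
    exact one_div_nonneg.2 (sub_nonneg.2 (two_rpow_lt_one hθ).le)
  set B := ‖f 0‖ + (‖Matrix.toEuclideanCLM (𝕜 := ℝ) A‖ + Cf) * S with hB
  have hB0 : 0 ≤ B := by positivity
  refine IsHolderOn.of_norm_sub_le hβ (C := T ^ (1 - β) * B +
    (‖g 0‖ + Cg * S) * (Cx * T ^ (ν - β)) +
      youngConst β₀ ν / 2 * (Cg * H * Cx * T ^ (β₀ + ν - β))) (by positivity)
    fun s t hs hst ht => ?_
  have hsplit : ∀ γ, β ≤ γ → 0 < γ → (t - s) ^ γ ≤ T ^ (γ - β) * (t - s) ^ β := by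
    intro γ hγ hγ0
    have h0 : 0 ≤ t - s := sub_nonneg.2 hst
    calc (t - s) ^ γ = (t - s) ^ (γ - β) * (t - s) ^ β := by
          rw [← Real.rpow_add_of_nonneg h0 (by linarith) hβ, sub_add_cancel]
      _ ≤ _ := by
          have := Real.rpow_nonneg h0 β
          gcongr
          linarith
  have key := hy.norm_sub_le (S := S) (α := β₀) (ν := ν) hr hβ₀ hf hCg hg hs hst hβ₀.le hν hθ hS hH
    hCx
    (fun v hv hvt => norm_le_supNormOn (hy.continuousOn hβ₀ _ _ le_rfl) (by linarith) (by linarith))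
    (fun u v hu huv hv => hyH u v (by linarith) huv (hv.trans ht))
    (fun u v hu huv hv => hxC u v (by linarith) huv (hv.trans ht))
  refine key.trans ?_
  have h1 := hsplit 1 hβ1 one_pos
  rw [Real.rpow_one] at h1
  have hν0 : 0 < ν ∨ ν = 0 := hν.lt_or_eq.imp_right Eq.symm
  have h2 : (t - s) ^ ν ≤ T ^ (ν - β) * (t - s) ^ β := by
    rcases hν0 with h | h
    · exact hsplit ν hβν h
    · have : β = 0 := by linarith
      simp [h, this]
  have h3 := hsplit (β₀ + ν) (by linarith) (by linarith)
  calc _ ≤ (T ^ (1 - β) * (t - s) ^ β) * B +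
        (‖g 0‖ + Cg * S) * (Cx * (T ^ (ν - β) * (t - s) ^ β)) +
        youngConst β₀ ν / 2 * (Cg * H * Cx * (T ^ (β₀ + ν - β) * (t - s) ^ β)) := by gcongr
    _ = _ := by ring

end Delay

/-- With `a = 1 / (2 * (K + 1)) ≤ 1 / 6`, the coefficient of `z` on the right is `1/4 + a + (1/4 -
a/2) ≤ 7/12`. Absorbing it gives `z ≤ S + H + 4 * r * φ + γ`, and `S' + H'` exceeds `S + H` by at
most `2 * z`. -/
theorem growth_step_arith {z S S' H H' K ℓ L r φ γ : ℝ} (hz : 0 ≤ z) (hS : 0 ≤ S) (hH : 0 ≤ H)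
    (hK : 2 ≤ K) (hℓ : ℓ * L ≤ 1 / 4) (hℓ0 : 0 ≤ ℓ) (hℓr : ℓ ≤ r) (hφ : 0 ≤ φ) (hγ : 0 ≤ γ)
    (hL : 0 ≤ L) (hS' : S' ≤ S + z) (hH' : H' ≤ H + z)
    (h : z ≤ ℓ * (φ + L * S') + 1 / (2 * (K + 1)) * (γ + S') + 1 / (2 * (K + 1)) * (K / 2) * H') :
    S' + H' + (4 * r * φ + γ) ≤ 3 * (S + H + (4 * r * φ + γ)) := by
  set a := 1 / (2 * (K + 1)) with ha
  have ha0 : 0 < a := by positivity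
  have haK : a * (K / 2) = 1 / 4 - a / 2 := by rw [ha]; field_simp; ring
  have ha6 : a ≤ 1 / 6 := by
    rw [ha]
    exact one_div_le_one_div_of_le (by norm_num) (by linarith)
  rw [haK] at h
  have hSz : 0 ≤ S + z := by linarith
  have hHz : 0 ≤ H + z := by linarith
  have h1 : ℓ * (φ + L * S') ≤ r * φ + 1 / 4 * (S + z) := by
    have e1 : ℓ * L * S' ≤ ℓ * L * (S + z) := by gcongr
    have e2 : ℓ * L * (S + z) ≤ 1 / 4 * (S + z) := by gcongr
    have e3 : ℓ * φ ≤ r * φ := by gcongr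
    linarith
  have h2 : a * (γ + S') ≤ 1 / 6 * γ + a * (S + z) := by
    have e1 : a * S' ≤ a * (S + z) := by gcongr
    have e2 : a * γ ≤ 1 / 6 * γ := by gcongr
    linarith
  have h3 : (1 / 4 - a / 2) * H' ≤ (1 / 4 - a / 2) * (H + z) :=
    mul_le_mul_of_nonneg_left hH' (by linarith)
  have h4 : a * z ≤ 1 / 6 * z := by gcongr
  have h5 : a * S ≤ 1 / 6 * S := by gcongr
  have h6 : 0 ≤ a * H := by positivity
  have h7 : 0 ≤ r * φ := mul_nonneg (hℓ0.trans hℓr) hφ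
  nlinarith

/-- The total growth factor: `n` steps caused by the greedy times, `M - 1` steps caused by the
uniform partition, and the comparison of the two Hölder weights. -/
theorem natCast_mul_three_pow_le_exp {X : ℝ} {M n k : ℕ} (hX : 0 ≤ X) (hM : (M : ℝ) ≤ X)
    (hk : k = n + 1 + M) :
    ((M + 1 : ℕ) : ℝ) * 3 ^ k ≤ Real.exp (X + (X + 2) * (n + 1 : ℕ)) := by
  have h2 : ((M + 1 : ℕ) : ℝ) ≤ 2 ^ k := by
    have h : M + 1 ≤ 2 ^ M := Nat.lt_two_pow_self
    calc ((M + 1 : ℕ) : ℝ) ≤ 2 ^ M := by exact_mod_cast h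
      _ ≤ 2 ^ k := pow_le_pow_right₀ (by norm_num) (by omega)
  -- The factors `2 ^ k` and `3 ^ k` combine to `6 ^ k`, and `6 ≤ e ^ 2`.
  have h6 : (6 : ℝ) ≤ Real.exp 2 := by
    have := Real.exp_one_gt_d9
    rw [show (2 : ℝ) = 1 + 1 by norm_num, Real.exp_add]
    nlinarith
  calc ((M + 1 : ℕ) : ℝ) * 3 ^ k ≤ 2 ^ k * 3 ^ k := by gcongr
    _ = 6 ^ k := by rw [← mul_pow]; norm_num
    _ ≤ Real.exp 2 ^ k := by gcongr
    _ = Real.exp (k * 2) := by rw [Real.exp_nat_mul]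
    _ ≤ _ := by
      apply Real.exp_le_exp.2
      rw [hk]
      push_cast
      have : 0 ≤ X * n := by positivity
      nlinarith

/-! ### Growth of the solution over one delay interval. -/

section Delay

variable {d m : ℕ} {r : ℝ} {y : ℝ → EuclideanSpace ℝ (Fin d)}
  {β₀ ν β : ℝ} {A : Matrix (Fin d) (Fin d) ℝ}
  {f : DelaySpace r d → EuclideanSpace ℝ (Fin d)} {Cf : ℝ≥0}
  {g : DelaySpace r d → EuclideanSpace ℝ (Fin m) →L[ℝ] EuclideanSpace ℝ (Fin d)} {Cg : ℝ}
  {x : ℝ → EuclideanSpace ℝ (Fin m)} {η : DelaySpace r d}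

theorem supNormOn_le_add {E : Type*} [NormedAddCommGroup E] {y : ℝ → E} {a p q ℓ : ℝ}
    (hβ : 0 ≤ β) (hap : a ≤ p) (hpq : p ≤ q)
    (hℓ : q - p ≤ ℓ) (hyc : ContinuousOn y (Icc a q)) (hy : IsHolderOn β y (Icc p q)) :
    supNormOn y a q ≤ supNormOn y a p + ℓ ^ β * holderSeminorm β y p q := by
  have hS : 0 ≤ supNormOn y a p := supNormOn_nonneg
  have hz : 0 ≤ ℓ ^ β * holderSeminorm β y p q :=
    mul_nonneg (Real.rpow_nonneg (by linarith) _) holderSeminorm_nonneg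
  have hyp := hyc.mono (Icc_subset_Icc_right hpq)
  refine supNormOn_le (by positivity) fun t hat htq => ?_
  rcases le_total t p with htp | hpt
  · linarith [norm_le_supNormOn hyp hat htp]
  have h1 := norm_sub_le_holderSeminorm hβ hy le_rfl hpt htq
  have h2 : holderSeminorm β y p q * (t - p) ^ β ≤ holderSeminorm β y p q * ℓ ^ β := by
    have := holderSeminorm_nonneg (α := β) (h := y) (a := p) (b := q)
    gcongr
    linarith
  have h3 := norm_le_norm_add_norm_sub (y p) (y t)
  rw [norm_sub_rev] at h3
  linarith [norm_le_supNormOn hyp hap le_rfl]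

theorem IsYoungDelaySolution.growth_step (hr : 0 < r) (hβ₀ : 0 < β₀)
    (hf : LipschitzWith Cf f) (hCg : 0 < Cg) (hg : ∀ ξ ζ, ‖g ξ - g ζ‖ ≤ Cg * ‖ξ - ζ‖)
    (hy : IsYoungDelaySolution r β₀ A f g x η y)
    (hβ : 0 < β) (hβν : β < ν) (hν1 : ν ≤ 1) (hθ : 1 < β + ν)
    {a p q ℓ μ : ℝ} (hyβ : IsHolderOn β y (Icc (a - r) q))
    (hμ : μ = 1 / (2 * (youngConst β ν + 1) * Cg * r ^ β))
    (ha : 0 ≤ a) (hap : a ≤ p) (hpq : p ≤ q) (hℓ : q - p ≤ ℓ) (hℓ0 : 0 < ℓ) (hℓr : ℓ ≤ r)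
    (hℓL : ℓ * (‖Matrix.toEuclideanCLM (𝕜 := ℝ) A‖ + Cf) ≤ 1 / 4)
    (hx : ∀ s t u v, p ≤ s → s ≤ u → u ≤ v → v ≤ t → t ≤ q →
      (t - s) ^ (ν - β) * ‖x v - x u‖ ≤ μ * (v - u) ^ ν) :
    supNormOn y (a - r) q + ℓ ^ β * holderSeminorm β y (a - r) q +
        (4 * r * ‖f 0‖ + ‖g 0‖ / Cg) ≤
      3 * (supNormOn y (a - r) p + ℓ ^ β * holderSeminorm β y (a - r) p +
        (4 * r * ‖f 0‖ + ‖g 0‖ / Cg)) := by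
  set L := ‖Matrix.toEuclideanCLM (𝕜 := ℝ) A‖ + Cf with hL
  set K := youngConst β ν with hKdef
  have hK : 2 ≤ K := two_le_youngConst hθ (by linarith)
  have hyc : ContinuousOn y (Icc (a - r) q) := hyβ.continuousOn hβ
  have hypq : IsHolderOn β y (Icc p q) := hyβ.mono (Icc_subset_Icc_left (by linarith))
  have hrβ : 0 < r ^ β := Real.rpow_pos_of_pos hr _
  have hℓβ : 0 < ℓ ^ β := Real.rpow_pos_of_pos hℓ0 _
  have hμ0 : 0 < μ := by rw [hμ]; positivity
  set S' := supNormOn y (a - r) q with hS'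
  set H' := holderSeminorm β y (a - r) q with hH'
  have hS0 : 0 ≤ S' := supNormOn_nonneg
  have hH0 : 0 ≤ H' := holderSeminorm_nonneg
  -- This is where the choice of `μ` enters: `Cg * μ * r ^ β = 1 / (2 * (K + 1))`, and `ℓ ≤ r`.
  have hμr : Cg * μ * ℓ ^ β ≤ 1 / (2 * (K + 1)) := by
    have : Cg * μ * ℓ ^ β = 1 / (2 * (K + 1)) * (ℓ ^ β / r ^ β) := by rw [hμ]; field_simp
    rw [this]
    refine mul_le_of_le_one_right (by positivity) ((div_le_one hrβ).2 ?_)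
    gcongr
  set B := ℓ ^ (1 - β) * (‖f 0‖ + L * S') + (‖g 0‖ + Cg * S') * μ +
    K / 2 * (Cg * H' * μ * ℓ ^ β) with hB
  have hB0 : 0 ≤ B := by positivity
  have hbound : holderSeminorm β y p q ≤ B := by
    refine holderSeminorm_le hB0 fun s t hs hst ht => ?_
    have hts : 0 < t - s := sub_pos.2 hst
    have hpow : 0 < (t - s) ^ (ν - β) := Real.rpow_pos_of_pos hts _
    -- The driver's Hölder constant is taken on `[s, t]` alone. The power `(t - s) ^ (ν - β)` in its
    -- denominator turns the order `ν` into `β`.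
    have key := hy.norm_sub_le (α := β) (ν := ν) (S := S') (H := H') (Cx := μ / (t - s) ^ (ν - β))
      hr.le hβ₀ hf hCg.le hg (by linarith : 0 ≤ s) hst.le hβ.le (by linarith) hθ
      hS0 hH0 (by positivity)
      (fun v hv hvt => norm_le_supNormOn hyc (by linarith) (by linarith))
      (fun u v hu huv hv => norm_sub_le_holderSeminorm hβ.le hyβ (by linarith) huv (by linarith))
      (fun u v hu huv hv => by
        rw [div_mul_eq_mul_div, le_div_iff₀ hpow, mul_comm]
        exact hx s t u v hs hu huv hv ht)
    have e1 : μ / (t - s) ^ (ν - β) * (t - s) ^ ν = μ * (t - s) ^ β := by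
      rw [div_mul_eq_mul_div, div_eq_iff hpow.ne', mul_assoc, ← Real.rpow_add hts]
      congr 2
      ring
    have e2 : Cg * H' * (μ / (t - s) ^ (ν - β)) * (t - s) ^ (β + ν) =
        Cg * H' * μ * (t - s) ^ β * (t - s) ^ β := by
      rw [add_comm β ν, Real.rpow_add hts]
      linear_combination Cg * H' * (t - s) ^ β * e1
    have e3 : t - s ≤ ℓ ^ (1 - β) * (t - s) ^ β := by
      calc t - s = (t - s) ^ (1 - β) * (t - s) ^ β := by
            rw [← Real.rpow_add hts, sub_add_cancel, Real.rpow_one]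
        _ ≤ _ := by
            gcongr
            · linarith
            · linarith
    have e4 : (t - s) ^ β ≤ ℓ ^ β := by
      gcongr
      linarith
    rw [e1, e2] at key
    refine key.trans ?_
    have hp : 0 ≤ (t - s) ^ β := by positivity
    calc _ ≤ (ℓ ^ (1 - β) * (t - s) ^ β) * (‖f 0‖ + L * S') +
          (‖g 0‖ + Cg * S') * (μ * (t - s) ^ β) +
          K / 2 * (Cg * H' * μ * ℓ ^ β * (t - s) ^ β) := by gcongr
      _ = _ := by rw [hB]; ring
  have hz : ℓ ^ β * holderSeminorm β y p q ≤ ℓ * (‖f 0‖ + L * S') +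
      1 / (2 * (K + 1)) * (‖g 0‖ / Cg + S') +
      1 / (2 * (K + 1)) * (K / 2) * (ℓ ^ β * H') := by
    have e1 : ℓ ^ β * ℓ ^ (1 - β) = ℓ := by
      rw [← Real.rpow_add hℓ0, add_sub_cancel, Real.rpow_one]
    calc _ ≤ ℓ ^ β * B := by gcongr
      _ = (ℓ ^ β * ℓ ^ (1 - β)) * (‖f 0‖ + L * S') +
          (Cg * μ * ℓ ^ β) * (‖g 0‖ / Cg + S') +
          (Cg * μ * ℓ ^ β) * (K / 2) * (ℓ ^ β * H') := by
        rw [hB]; field_simp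
      _ ≤ _ := by rw [e1]; gcongr
  refine growth_step_arith (z := ℓ ^ β * holderSeminorm β y p q) (K := K) (L := L)
    (mul_nonneg hℓβ.le holderSeminorm_nonneg) supNormOn_nonneg
    (mul_nonneg hℓβ.le holderSeminorm_nonneg) hK hℓL hℓ0.le hℓr (norm_nonneg _) (by positivity)
    (by positivity) (supNormOn_le_add hβ.le (by linarith) hpq hℓ hyc hypq) ?_ hz
  rw [← mul_add]
  gcongr
  exact holderSeminorm_le_add hβ.le hyβ (by linarith) hpq

theorem IsYoungDelaySolution.holderNorm_le (hr : 0 < r) (hβ₀ : 0 < β₀)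
    (hf : LipschitzWith Cf f) (hCg : 0 < Cg) (hg : ∀ ξ ζ, ‖g ξ - g ζ‖ ≤ Cg * ‖ξ - ζ‖)
    (hy : IsYoungDelaySolution r β₀ A f g x η y)
    (hβ : 0 < β) (hβν : β < ν) (hν1 : ν ≤ 1) (hθ : 1 < β + ν)
    {a μ L c : ℝ} (hyβ : IsHolderOn β y (Icc (a - r) (a + r)))
    (hxν : IsHolderOn ν x (Icc a (a + r)))
    (hμ : μ = 1 / (2 * (youngConst β ν + 1) * Cg * r ^ β))
    (hL : L = ‖Matrix.toEuclideanCLM (𝕜 := ℝ) A‖ + Cf) (hc : c = 4 * r * ‖f 0‖ + ‖g 0‖ / Cg)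
    (ha : 0 ≤ a) :
    holderNorm β y a (a + r) ≤
      Real.exp (4 * L * r + (4 * L * r + 2) * greedyCount μ ν β x a (a + r)) *
        (holderNorm β y (a - r) a + c) - c := by
  have hL0 : 0 ≤ L := by rw [hL]; positivity
  have hc0 : 0 ≤ c := by rw [hc]; positivity
  have hrβ : 0 < r ^ β := Real.rpow_pos_of_pos hr _
  have hab : a < a + r := by linarith
  have hν : 0 < ν := hβ.trans hβν
  have hμ0 : 0 < μ := by
    have := two_le_youngConst hθ (by linarith)
    rw [hμ]
    positivity
  set X := 4 * L * r with hX
  have hX0 : 0 ≤ X := by positivity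
  -- Then `M + 1 > 4 * L * r`, so cells of length `r / (M + 1)` satisfy `ℓ * L ≤ 1 / 4`.
  set M := ⌊X⌋₊ with hM
  have hMX : (M : ℝ) ≤ X := Nat.floor_le hX0
  have hXM : X < M + 1 := Nat.lt_floor_add_one X
  have hM1 : (1 : ℝ) ≤ M + 1 := by linarith [(Nat.cast_nonneg M : (0 : ℝ) ≤ M)]
  set ℓ := r / (M + 1) with hℓ
  have hℓ0 : 0 < ℓ := by positivity
  have hℓr : ℓ ≤ r := div_le_self hr.le hM1
  have hrℓ : r = (M + 1) * ℓ := by rw [hℓ]; field_simp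
  have hℓL : ℓ * L ≤ 1 / 4 := by
    rw [hℓ, div_mul_eq_mul_div, div_le_iff₀ (by linarith)]
    linarith
  have hrℓβ : r ^ β ≤ (M + 1) * ℓ ^ β := by
    rw [hrℓ, Real.mul_rpow (by linarith) hℓ0.le]
    gcongr
    exact (Real.rpow_le_rpow_of_exponent_le hM1 (by linarith)).trans_eq (Real.rpow_one _)
  let Φ : ℝ → ℝ := fun t => supNormOn y (a - r) t + ℓ ^ β * holderSeminorm β y (a - r) t + c
  have hyc : ContinuousOn y (Icc (a - r) (a + r)) := hyβ.continuousOn hβ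
  have hΦ0 : 0 ≤ Φ a := by
    have h1 : 0 ≤ supNormOn y (a - r) a := supNormOn_nonneg
    have h2 : 0 ≤ holderSeminorm β y (a - r) a := holderSeminorm_nonneg
    positivity
  set n := sSup (greedyIndices μ ν β x a (a + r)) with hn
  have hcount : greedyCount μ ν β x a (a + r) = n + 1 := by rw [greedyCount, add_comm]
  have hend := greedyTime_greedyCount hμ0 hν hβν hab.le hxν
  rw [hcount] at hend
  -- The endpoint `a + r` closes the greedy interval of index `n` and the uniform cell of index `M`,
  -- both counted from `0`.
  have hgrow : Φ (a + r) ≤ 3 ^ (n + M + 1) * Φ a := by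
    refine le_three_pow_of_two_partitions (σ := greedyTime μ ν β x a (a + r))
      (τ := fun j => a + j * ℓ) hΦ0 (greedyTime_monotone hμ0.le hβν hab.le) ?_ rfl (by simp) ?_
      (n + M) n M (a + r) rfl (greedyTime_le hμ0.le hβν hab.le n) hend.ge ?_ ?_
    · intro i j hij
      have : (i : ℝ) ≤ j := by exact_mod_cast hij
      dsimp only
      gcongr
    · intro i j p q hip hjp hpq hqi hqj
      have hap : a ≤ p := (le_greedyTime hμ0.le hβν hab.le i).trans hip
      have hqb : q ≤ a + r := hqi.trans (greedyTime_le hμ0.le hβν hab.le (i + 1))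
      have hx' : ∀ s t u v, p ≤ s → s ≤ u → u ≤ v → v ≤ t → t ≤ q →
          (t - s) ^ (ν - β) * ‖x v - x u‖ ≤ μ * (v - u) ^ ν := by
        intro s t u v hs hu huv hv ht
        refine le_trans ?_ (norm_sub_le_of_greedyTime hμ0.le hν hβν hab.le hxν i
          (by linarith : greedyTime μ ν β x a (a + r) i ≤ u) huv (by linarith))
        gcongr
        · linarith
        · linarith
        · linarith
      push_cast at hqj
      have := hy.growth_step (ℓ := ℓ) hr hβ₀ hf hCg hg hβ hβν hν1 hθ
        (hyβ.mono (Icc_subset_Icc_right hqb)) hμ ha hap hpq (by linarith) hℓ0 hℓr (hL ▸ hℓL) hx'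
      rw [← hc] at this
      exact this
    · rw [hrℓ]
      nlinarith
    · push_cast
      rw [← hrℓ]
  -- Since `β ≤ 1`, replacing the weight `ℓ ^ β` by `r ^ β` costs at most `M + 1`. At the initial
  -- time the change of weight is free, as `ℓ ≤ r`.
  have hfin : holderNorm β y a (a + r) + c ≤ (M + 1) * Φ (a + r) := by
    have h1 : supNormOn y a (a + r) ≤ supNormOn y (a - r) (a + r) :=
      supNormOn_mono hyc (by linarith) le_rfl
    have h2 : holderSeminorm β y a (a + r) ≤ holderSeminorm β y (a - r) (a + r) :=
      holderSeminorm_mono hβ.le hyβ (by linarith) le_rfl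
    have h3 : 0 ≤ supNormOn y (a - r) (a + r) := supNormOn_nonneg
    have h4 : 0 ≤ holderSeminorm β y (a - r) (a + r) := holderSeminorm_nonneg
    have h0 : 0 ≤ holderSeminorm β y a (a + r) := holderSeminorm_nonneg
    have h5 : r ^ β * holderSeminorm β y a (a + r) ≤
        (M + 1) * ℓ ^ β * holderSeminorm β y (a - r) (a + r) := by gcongr
    rw [holderNorm, add_sub_cancel_left]
    simp only [Φ]
    nlinarith
  have hini : Φ a ≤ holderNorm β y (a - r) a + c := by
    have h4 : 0 ≤ holderSeminorm β y (a - r) a := holderSeminorm_nonneg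
    rw [holderNorm, sub_sub_cancel]
    simp only [Φ]
    gcongr
  have hexp := natCast_mul_three_pow_le_exp (n := n) hX0 hMX
    (show n + M + 1 = n + 1 + M by ring)
  push_cast at hexp
  rw [hcount, le_sub_iff_add_le]
  push_cast
  calc holderNorm β y a (a + r) + c ≤ (M + 1) * Φ (a + r) := hfin
    _ ≤ (M + 1) * (3 ^ (n + M + 1) * Φ a) := by gcongr
    _ = ((M + 1) * 3 ^ (n + M + 1)) * Φ a := by ring
    _ ≤ _ := by gcongr

end Delay

/-! ### The main theorem. -/

theorem proposition2p2 {d m : ℕ} (r : ℝ) (hr : 0 < r)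
    (ν β₀ β : ℝ) (hν : 1 / 2 < ν) (hν1 : ν ≤ 1)
    (hβ₀ : β₀ ∈ Ioo (1 - ν) ν) (hβ : β ∈ Ioo β₀ ν)
    (A : Matrix (Fin d) (Fin d) ℝ)
    (f : DelaySpace r d → EuclideanSpace ℝ (Fin d)) (Cf : ℝ≥0) (hf : LipschitzWith Cf f)
    (g : DelaySpace r d → EuclideanSpace ℝ (Fin m) →L[ℝ] EuclideanSpace ℝ (Fin d))
    (Cg : ℝ) (hCg : 0 < Cg) (hg : ContDiff ℝ 1 g) (hDg : ∀ ξ, ‖fderiv ℝ g ξ‖ ≤ Cg)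
    (x : ℝ → EuclideanSpace ℝ (Fin m)) (hx : ∀ T > 0, IsHolderOn ν x (Icc 0 T))
    (η : DelaySpace r d) (y : ℝ → EuclideanSpace ℝ (Fin d))
    (hy : IsYoungDelaySolution r β₀ A f g x η y)
    (K μ Lf κ c : ℝ) (hK : K = youngConst β ν)
    (hμ : μ = 1 / (2 * (K + 1) * Cg * r ^ β))
    (hLf : Lf = ‖Matrix.toEuclideanCLM (𝕜 := ℝ) A‖ + Cf)
    (hκ : κ = 4 * Lf * r + 2)
    (hc : c = 4 * r * ‖f 0‖ + ‖g 0‖ / Cg)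
    (n : ℕ) (hn : 1 ≤ n) :
    -- the solution is `β`-Hölder on the intervals involved
    IsHolderOn β y (Icc 0 ((n + 1) * r)) ∧
    -- the greedy sequence reaches the end of the interval `[nr, (n+1)r]`
    (greedyIndices μ ν β x (n * r) ((n + 1) * r)).Finite ∧
    holderNorm β y (n * r) ((n + 1) * r) ≤
      Real.exp (4 * Lf * r + κ * greedyCount μ ν β x (n * r) ((n + 1) * r)) *
        (holderNorm β y ((n - 1) * r) (n * r) + c) - c ∧
    (greedyCount μ ν β x (n * r) ((n + 1) * r) : ℝ) ≤
      1 + (2 * (K + 1) * Cg * r ^ ν) ^ (1 / (ν - β)) *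
        holderSeminorm ν x (n * r) ((n + 1) * r) ^ (1 / (ν - β)) := by
  have hν0 : 0 < ν := by linarith
  have hβ₀0 : 0 < β₀ := by linarith [hβ₀.1]
  have hβ0 : 0 < β := hβ₀0.trans hβ.1
  have hθ : 1 < β + ν := by linarith [hβ₀.1, hβ.1]
  have hn1 : (1 : ℝ) ≤ n := by exact_mod_cast hn
  have hgl : ∀ ξ ζ, ‖g ξ - g ζ‖ ≤ Cg * ‖ξ - ζ‖ := fun ξ ζ =>
    convex_univ.norm_image_sub_le_of_norm_fderiv_le
      (fun z _ => (hg.differentiable one_ne_zero).differentiableAt) (fun z _ => hDg z)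
      (mem_univ _) (mem_univ _)
  have hT : 0 < (n + 1) * r := by positivity
  have ha : 0 ≤ n * r := by positivity
  have hab : (n + 1) * r = n * r + r := by ring
  have har : (n - 1) * r = n * r - r := by ring
  -- As `n ≥ 1`, the window starting at `n * r - r` stays in `[0, ∞)`, where `y` is `β`-Hölder.
  have har0 : 0 ≤ n * r - r := by nlinarith
  have hK0 : 0 < K := by
    rw [hK]
    linarith [two_le_youngConst hθ (by linarith [hβ.2])]
  have hμ0 : 0 < μ := by rw [hμ]; positivity
  have hyβ : IsHolderOn β y (Icc 0 ((n + 1) * r)) :=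
    hy.isHolderOn hr.le hβ₀0 hf hCg.le hgl hT hν0.le (by linarith [hβ₀.1]) hβ0.le
      (by linarith [hβ.2]) hβ.2.le (hx _ hT)
  have hxν : IsHolderOn ν x (Icc (n * r) ((n + 1) * r)) :=
    (hx _ hT).mono (Icc_subset_Icc_left ha)
  rw [hab] at hyβ hxν
  rw [hab, har]
  refine ⟨hyβ, (bddAbove_greedyIndices hμ0 hν0 hβ.2 (by linarith) hxν).finite, ?_, ?_⟩
  · have := hy.holderNorm_le hr hβ₀0 hf hCg hgl hβ0 hβ.2 hν1 hθ
      (hyβ.mono (Icc_subset_Icc_left har0)) hxν (hK ▸ hμ) hLf hc ha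
    rwa [hκ]
  · refine (greedyCount_le hμ0 hν0 hβ.2 (by linarith) hxν).trans_eq ?_
    have hγ : 0 < ν - β := sub_pos.2 hβ.2
    set h := holderSeminorm ν x (n * r) (n * r + r)
    have hh : 0 ≤ h := holderSeminorm_nonneg
    have hrβ := Real.rpow_pos_of_pos hr β
    -- The length `r` is moved inside the power; together with the `r ^ β` of `1 / μ` it yields `r ^
    -- ν`.
    have e1 : r = (r ^ (ν - β)) ^ (1 / (ν - β)) := by
      rw [← Real.rpow_mul hr.le, mul_one_div_cancel hγ.ne', Real.rpow_one]
    have e2 : r ^ (ν - β) * (h / μ) = 2 * (K + 1) * Cg * r ^ ν * h := by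
      rw [hμ, show r ^ ν = r ^ (ν - β) * r ^ β by rw [← Real.rpow_add hr, sub_add_cancel]]
      field_simp
    have e3 : r * (h / μ) ^ (1 / (ν - β)) =
        (2 * (K + 1) * Cg * r ^ ν) ^ (1 / (ν - β)) * h ^ (1 / (ν - β)) := by
      conv_lhs => rw [e1]
      rw [← Real.mul_rpow (by positivity) (by positivity), e2,
        Real.mul_rpow (by positivity) hh]
    rw [add_sub_cancel_left, e3]
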